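/- Let $I\subseteq\mathbb R$ be an open interval and let $f:I\to(0,\infty)$ and $\phi:I\to\mathbb R$ be smooth. Let $\mathbb H^3$ be the Heisenberg group of real matrices $$\begin{pmatrix}1&x&y\\0&1&z\\0&0&1\end{pmatrix},$$ identified with $\mathbb R^3$ through the coordinates $(x,y,z)$ and endowed with the left-invariant metric $g_{\mathbb H}=dx^2+(dy-x\,dz)^2+dz^2$, let $e_1=\partial/\partial x$, and let $a:\mathbb H^3\to\mathbb R$ be smooth. Let $I\times_f\mathbb H^3$ be the warped product, i.e. $I\times\mathbb H^3$ with the metric $dt^2+f(t)^2g_{\mathbb H}$. A smooth vector field $V$ on a Riemannian manifold $(M,g)$ is called harmonic if it is a critical point of the vertical energy $E^v(V;D)=\frac12\int_D\|\nabla V\|^2v_g$ with respect to variations through vector fields, i.e. $\frac{d}{ds}\big|_{s=0}E^v(V+sW;D)=0$ for every compact $D\subseteq M$ and every smooth vector field $W$ supported in $D$. Consider on $I\times_f\mathbb H^3$ the vector field $V=\phi(t)\,\partial_t+a(x,y,z)\,e_1$. Suppose that $f$ is not constant and that $a$ is not identically zero. Then $V$ is harmonic if and only if there are constants $\kappa,\kappa'\in\mathbb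 R$ such that $$\begin{cases}a(x,y,z)=\kappa x+\kappa' &\text{for all }(x,y,z),\\[2pt] f(t)f''(t)+2f'(t)^2=\tfrac12 &\text{for all }t\in I,\\[2pt] \phi''(t)+3\dfrac{f'(t)}{f(t)}\phi'(t)-3\Big(\dfrac{f'(t)}{f(t)}\Big)^2\phi(t)=2\kappa\dfrac{f'(t)}{f(t)} &\text{for all }t\in I.\end{cases}$$ Moreover, these three conditions imply that $V$ is harmonic also without the assumptions that $f$ is not constant and that $a$ is not identically zero. -/

import Mathlib

open scoped ContDiff

noncomputable section

namespace WarpedHarmonic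

/-! Riemannian geometry in one global chart: `ι` is the finite set of coordinate indices, a point
has coordinates `p : ι → ℝ`, a metric is the field of its matrices `g p = (g_{ij}(p))`, and a
vector field is the field of its components `V p = (V^k(p))` in the coordinate frame. -/

variable {ι : Type*} [Fintype ι] [DecidableEq ι]

/-- The partial derivative `∂_i h` at `p`. -/
def partialDeriv (i : ι) (h : (ι → ℝ) → ℝ) (p : ι → ℝ) : ℝ :=
  fderiv ℝ h p (Pi.single i 1)

/-- The Christoffel symbols
`Γ^k_{ij} = ½ ∑_l g^{kl} (∂_i g_{jl} + ∂_j g_{il} - ∂_l g_{ij})` of the Levi-Civita connection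
of `g`. -/
def christoffel (g : (ι → ℝ) → Matrix ι ι ℝ) (k i j : ι) (p : ι → ℝ) : ℝ :=
  (1 / 2) * ∑ l, (g p)⁻¹ k l *
    (partialDeriv i (fun q => g q j l) p + partialDeriv j (fun q => g q i l) p
      - partialDeriv l (fun q => g q i j) p)

/-- The `k`-th component `∂_i V^k + ∑_j Γ^k_{ij} V^j` of the Levi-Civita covariant derivative
`∇_{∂_i} V`. -/
def covDeriv (g : (ι → ℝ) → Matrix ι ι ℝ) (V : (ι → ℝ) → ι → ℝ) (i k : ι) (p : ι → ℝ) : ℝ :=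
  partialDeriv i (fun q => V q k) p + ∑ j, christoffel g k i j p * V p j

/-- The squared norm `‖∇V‖² = ∑ g^{ij} g_{kl} (∇_i V)^k (∇_j V)^l`; this is
`∑_i g(∇_{E_i} V, ∇_{E_i} V)` for any `g`-orthonormal frame `(E_i)`. -/
def normSqCovDeriv (g : (ι → ℝ) → Matrix ι ι ℝ) (V : (ι → ℝ) → ι → ℝ) (p : ι → ℝ) : ℝ :=
  ∑ i, ∑ j, ∑ k, ∑ l,
    (g p)⁻¹ i j * g p k l * covDeriv g V i k p * covDeriv g V j l p

/-- The vertical energy `E^v(V; D) = ½ ∫_D ‖∇V‖² v_g`, with the Riemannian volume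
`v_g = √(det g) dp`. -/
def verticalEnergy (g : (ι → ℝ) → Matrix ι ι ℝ) (D : Set (ι → ℝ)) (V : (ι → ℝ) → ι → ℝ) : ℝ :=
  (1 / 2) * ∫ p in D, normSqCovDeriv g V p * Real.sqrt (g p).det

/-- A smooth vector field `V` on the Riemannian manifold `(U, g)`, `U` an open set of `ℝ^ι`, is
harmonic if it is a critical point of the vertical energy with respect to variations through
vector fields: for every compact `D ⊆ U` and every smooth vector field `W` supported in `D`,
`d/ds E^v(V + s W; D) = 0` at `s = 0`. -/
def IsHarmonicField (g : (ι → ℝ) → Matrix ι ι ℝ) (U : Set (ι → ℝ))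
    (V : (ι → ℝ) → ι → ℝ) : Prop :=
  ∀ D : Set (ι → ℝ), IsCompact D → D ⊆ U →
    ∀ W : (ι → ℝ) → ι → ℝ, ContDiff ℝ ∞ W → tsupport W ⊆ D →
      HasDerivAt (fun s : ℝ => verticalEnergy g D (fun p => V p + s • W p)) 0 0

/-- The warped product metric `π^* g_B ⊕ (f ∘ π)² σ^* g_F` on `B × F`, where `β` and `γ` index the
coordinates of `B` and `F`. -/
def warpedMetric {β γ : Type*} (gB : (β → ℝ) → Matrix β β ℝ) (gF : (γ → ℝ) → Matrix γ γ ℝ)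
    (f : (β → ℝ) → ℝ) (p : β ⊕ γ → ℝ) : Matrix (β ⊕ γ) (β ⊕ γ) ℝ :=
  Matrix.fromBlocks (gB (p ∘ Sum.inl)) 0 0 ((f (p ∘ Sum.inl)) ^ 2 • gF (p ∘ Sum.inr))

/-- The vector field `V₁ + V₂` on `B × F` for vector fields `V₁` on `B` and `V₂` on `F`. -/
def sumField {β γ : Type*} (V₁ : (β → ℝ) → β → ℝ) (V₂ : (γ → ℝ) → γ → ℝ)
    (p : β ⊕ γ → ℝ) : β ⊕ γ → ℝ :=
  Sum.elim (V₁ (p ∘ Sum.inl)) (V₂ (p ∘ Sum.inr))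

/-- The left-invariant metric `dx² + (dy - x dz)² + dz²` on the Heisenberg group of the matrices
`!![1, x, y; 0, 1, z; 0, 0, 1]`, in the global coordinates `q = (x, y, z)`. -/
def heisenbergMetric (q : Fin 3 → ℝ) : Matrix (Fin 3) (Fin 3) ℝ :=
  !![1, 0, 0;
     0, 1, -q 0;
     0, -q 0, 1 + q 0 ^ 2]

/-- The left-invariant unit vector field `e₁ = ∂/∂x` on the Heisenberg group. -/
def heisenbergE₁ (_q : Fin 3 → ℝ) : Fin 3 → ℝ := ![1, 0, 0]

/-- The metric `dt² + f(t)² (dx² + (dy - x dz)² + dz²)` of `I ×_f ℍ³`. -/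
def heisenbergWarpedMetric (f : ℝ → ℝ) :
    (Fin 1 ⊕ Fin 3 → ℝ) → Matrix (Fin 1 ⊕ Fin 3) (Fin 1 ⊕ Fin 3) ℝ :=
  warpedMetric (fun _ => 1) heisenbergMetric (fun b => f (b 0))

/-- The underlying open set of `I ×_f ℍ³`: the points `(t, x, y, z)` with `t ∈ I`. -/
def warpedDomain (I : Set ℝ) : Set (Fin 1 ⊕ Fin 3 → ℝ) := {p | p (Sum.inl 0) ∈ I}

/-- The vector field `V = φ(t) ∂_t + a(x, y, z) e₁`. -/
def heisenbergField (φ : ℝ → ℝ) (a : (Fin 3 → ℝ) → ℝ) :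
    (Fin 1 ⊕ Fin 3 → ℝ) → Fin 1 ⊕ Fin 3 → ℝ :=
  sumField (fun b _ => φ (b 0)) (fun q => a q • heisenbergE₁ q)

/-- The three conditions: for some constants `κ, κ'`, the function `a` is `κ x + κ'`, and on `I`
`f f'' + 2 f'² = 1/2` and `φ'' + 3 (f'/f) φ' - 3 (f'/f)² φ = 2 κ f'/f`. -/
def HeisenbergConditions (I : Set ℝ) (f φ : ℝ → ℝ) (a : (Fin 3 → ℝ) → ℝ) : Prop :=
  ∃ κ κ' : ℝ,
    (∀ q, a q = κ * q 0 + κ') ∧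
    (∀ t ∈ I, f t * deriv (deriv f) t + 2 * (deriv f t) ^ 2 = 1 / 2) ∧
    (∀ t ∈ I, deriv (deriv φ) t + 3 * (deriv f t / f t) * deriv φ t
      - 3 * (deriv f t / f t) ^ 2 * φ t = 2 * κ * (deriv f t / f t))

end WarpedHarmonic

end

noncomputable section

namespace WarpedHarmonic

open MeasureTheory

/-! ### Partial derivatives -/

section PartialDeriv

variable {ι : Type*} [DecidableEq ι]

/-! The connection is linear, so the vertical energy of `V + s W` is a quadratic polynomial in `s`,
with linear coefficient `∫ ⟨∇W, ∇V⟩ v_g`. Integration by parts turns this into a pairing of `W` with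
the rough Laplacian of `V`, and the fundamental lemma of the calculus of variations shows that `V`
is harmonic exactly when that Laplacian vanishes (`isHarmonicField_iff_roughLaplacian_eq_zero`).

For `V = φ ∂_t + a e₁` the Laplacian is computed in coordinates (`roughLaplacian_heisenbergField`).
With `e₂ = ∂_y` and `e₃ = ∂_z + x ∂_y`, its `y` and `z` components vanish iff `e₂ a = e₃ a = 0`,
i.e. `a` depends on `x` only. Two equations remain: `φ'' + 3 (f'/f) φ' - 3 (f'/f)² φ = 2 a_x f'/f`
and `a_xx = a (1/2 - (f f'' + 2 f'²))`.

The variables now separate. At a time with `f' ≠ 0` the first equation forces `a_x` to be a constant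
`κ`. Then `a` is affine in `x` and `a_xx = 0`, so the second equation, at a point with `a ≠ 0`, is
the equation for `f`. The converse is substitution and needs neither nonvanishing assumption. -/

lemma partialDeriv_congr_on {U : Set (ι → ℝ)} (hU : IsOpen U) {u v : (ι → ℝ) → ℝ}
    (h : ∀ q ∈ U, u q = v q) {p : ι → ℝ} (hp : p ∈ U) (i : ι) :
    partialDeriv i u p = partialDeriv i v p := by
  unfold partialDeriv
  rw [Filter.EventuallyEq.fderiv_eq (Filter.eventuallyEq_of_mem (hU.mem_nhds hp) h)]

lemma partialDeriv_eq_zero_of_notMem_tsupport {u : (ι → ℝ) → ℝ} {p : ι → ℝ}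
    (hp : p ∉ tsupport u) (i : ι) : partialDeriv i u p = 0 := by
  have h : fderiv ℝ u p = 0 := by
    by_contra h
    exact hp (support_fderiv_subset ℝ h)
  simp [partialDeriv, h]

end PartialDeriv

section General

variable {ι : Type*} [Fintype ι] [DecidableEq ι]

lemma partialDeriv_add {i : ι} {u v : (ι → ℝ) → ℝ} {p : ι → ℝ}
    (hu : DifferentiableAt ℝ u p) (hv : DifferentiableAt ℝ v p) :
    partialDeriv i (fun q => u q + v q) p = partialDeriv i u p + partialDeriv i v p := by
  simp [partialDeriv, fderiv_fun_add hu hv]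

lemma partialDeriv_const_mul {i : ι} (c : ℝ) {u : (ι → ℝ) → ℝ} {p : ι → ℝ}
    (hu : DifferentiableAt ℝ u p) :
    partialDeriv i (fun q => c * u q) p = c * partialDeriv i u p := by
  simp [partialDeriv, fderiv_const_mul hu]

lemma contDiffOn_partialDeriv {U : Set (ι → ℝ)} (hU : IsOpen U) {u : (ι → ℝ) → ℝ}
    (hu : ContDiffOn ℝ ∞ u U) (i : ι) : ContDiffOn ℝ ∞ (partialDeriv i u) U :=
  (hu.fderiv_of_isOpen hU (m := ∞) (by simp)).clm_apply contDiffOn_const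

/-! ### Smoothness of the geometric quantities -/

variable {U : Set (ι → ℝ)} {g : (ι → ℝ) → Matrix ι ι ℝ} {V W : (ι → ℝ) → ι → ℝ}

lemma contDiffOn_det {A : (ι → ℝ) → Matrix ι ι ℝ}
    (hA : ∀ i j, ContDiffOn ℝ ∞ (fun p => A p i j) U) :
    ContDiffOn ℝ ∞ (fun p => (A p).det) U := by
  simp only [Matrix.det_apply]
  exact ContDiffOn.sum fun σ _ =>
    (contDiffOn_prod fun i _ => hA (σ i) i).const_smul (Equiv.Perm.sign σ)

lemma contDiffOn_inv (hg : ∀ i j, ContDiffOn ℝ ∞ (fun p => g p i j) U)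
    (hdet : ∀ p ∈ U, 0 < (g p).det) (i j : ι) :
    ContDiffOn ℝ ∞ (fun p => (g p)⁻¹ i j) U := by
  simp only [Matrix.inv_def, Matrix.smul_apply, Ring.inverse_eq_inv', smul_eq_mul,
    Matrix.adjugate_apply]
  refine ((contDiffOn_det hg).inv fun p hp => (hdet p hp).ne').mul (contDiffOn_det fun k l => ?_)
  simp only [Matrix.updateRow_apply]
  split_ifs
  · exact contDiffOn_const
  · exact hg k l

lemma contDiffOn_sqrt_det (hg : ∀ i j, ContDiffOn ℝ ∞ (fun p => g p i j) U)
    (hdet : ∀ p ∈ U, 0 < (g p).det) :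
    ContDiffOn ℝ ∞ (fun p => Real.sqrt (g p).det) U :=
  (contDiffOn_det hg).sqrt fun p hp => (hdet p hp).ne'

lemma contDiffOn_christoffel (hU : IsOpen U)
    (hg : ∀ i j, ContDiffOn ℝ ∞ (fun p => g p i j) U)
    (hdet : ∀ p ∈ U, 0 < (g p).det) (k i j : ι) :
    ContDiffOn ℝ ∞ (christoffel g k i j) U := by
  unfold christoffel
  exact contDiffOn_const.mul <| ContDiffOn.sum fun l _ =>
    (contDiffOn_inv hg hdet k l).mul <|
      ((contDiffOn_partialDeriv hU (hg j l) i).add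
        (contDiffOn_partialDeriv hU (hg i l) j)).sub (contDiffOn_partialDeriv hU (hg i j) l)

lemma contDiffOn_covDeriv (hU : IsOpen U)
    (hg : ∀ i j, ContDiffOn ℝ ∞ (fun p => g p i j) U)
    (hdet : ∀ p ∈ U, 0 < (g p).det) (hV : ∀ k, ContDiffOn ℝ ∞ (fun p => V p k) U) (i k : ι) :
    ContDiffOn ℝ ∞ (covDeriv g V i k) U := by
  unfold covDeriv
  exact (contDiffOn_partialDeriv hU (hV k) i).add <| ContDiffOn.sum fun j _ =>
    (contDiffOn_christoffel hU hg hdet k i j).mul (hV j)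

/-- The inner product `⟨∇V, ∇W⟩ = ∑ g^{ij} g_{kl} (∇_i V)^k (∇_j W)^l`. -/
def innerCovDeriv (g : (ι → ℝ) → Matrix ι ι ℝ) (V W : (ι → ℝ) → ι → ℝ) (p : ι → ℝ) : ℝ :=
  ∑ i, ∑ j, ∑ k, ∑ l,
    (g p)⁻¹ i j * g p k l * covDeriv g V i k p * covDeriv g W j l p

/-- The densitized covariant derivative `√(det g) ∑ g^{ij} g_{kl} (∇_j V)^l`. -/
def momentum (g : (ι → ℝ) → Matrix ι ι ℝ) (V : (ι → ℝ) → ι → ℝ) (i k : ι) (p : ι → ℝ) : ℝ :=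
  (∑ j, ∑ l, (g p)⁻¹ i j * g p k l * covDeriv g V j l p) * Real.sqrt (g p).det

/-- The components of the rough Laplacian `∇^*∇V`, with lowered index and multiplied by
`√(det g)`. -/
def roughLaplacian (g : (ι → ℝ) → Matrix ι ι ℝ) (V : (ι → ℝ) → ι → ℝ) (m : ι) (p : ι → ℝ) : ℝ :=
  ∑ i, ((∑ k, christoffel g k i m p * momentum g V i k p) - partialDeriv i (momentum g V i m) p)

lemma contDiffOn_innerCovDeriv (hU : IsOpen U)
    (hg : ∀ i j, ContDiffOn ℝ ∞ (fun p => g p i j) U)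
    (hdet : ∀ p ∈ U, 0 < (g p).det) (hV : ∀ k, ContDiffOn ℝ ∞ (fun p => V p k) U)
    (hW : ∀ k, ContDiffOn ℝ ∞ (fun p => W p k) U) :
    ContDiffOn ℝ ∞ (innerCovDeriv g V W) U := by
  unfold innerCovDeriv
  exact ContDiffOn.sum fun i _ => ContDiffOn.sum fun j _ => ContDiffOn.sum fun k _ =>
    ContDiffOn.sum fun l _ => (((contDiffOn_inv hg hdet i j).mul (hg k l)).mul
      (contDiffOn_covDeriv hU hg hdet hV i k)).mul (contDiffOn_covDeriv hU hg hdet hW j l)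

lemma contDiffOn_momentum (hU : IsOpen U)
    (hg : ∀ i j, ContDiffOn ℝ ∞ (fun p => g p i j) U)
    (hdet : ∀ p ∈ U, 0 < (g p).det) (hV : ∀ k, ContDiffOn ℝ ∞ (fun p => V p k) U) (i k : ι) :
    ContDiffOn ℝ ∞ (momentum g V i k) U := by
  unfold momentum
  exact (ContDiffOn.sum fun j _ => ContDiffOn.sum fun l _ =>
    ((contDiffOn_inv hg hdet i j).mul (hg k l)).mul
      (contDiffOn_covDeriv hU hg hdet hV j l)).mul (contDiffOn_sqrt_det hg hdet)

lemma contDiffOn_roughLaplacian (hU : IsOpen U)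
    (hg : ∀ i j, ContDiffOn ℝ ∞ (fun p => g p i j) U)
    (hdet : ∀ p ∈ U, 0 < (g p).det) (hV : ∀ k, ContDiffOn ℝ ∞ (fun p => V p k) U) (m : ι) :
    ContDiffOn ℝ ∞ (roughLaplacian g V m) U := by
  unfold roughLaplacian
  exact ContDiffOn.sum fun i _ => (ContDiffOn.sum fun k _ =>
    (contDiffOn_christoffel hU hg hdet k i m).mul (contDiffOn_momentum hU hg hdet hV i k)).sub
      (contDiffOn_partialDeriv hU (contDiffOn_momentum hU hg hdet hV i m) i)

/-! ### First variation of the vertical energy -/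

lemma covDeriv_add_smul {p : ι → ℝ} (hV : ∀ k, DifferentiableAt ℝ (fun q => V q k) p)
    (hW : ∀ k, DifferentiableAt ℝ (fun q => W q k) p) (s : ℝ) (i k : ι) :
    covDeriv g (fun q => V q + s • W q) i k p
      = covDeriv g V i k p + s * covDeriv g W i k p := by
  simp only [covDeriv, Pi.add_apply, Pi.smul_apply, smul_eq_mul]
  rw [partialDeriv_add (hV k) ((hW k).const_mul s), partialDeriv_const_mul s (hW k)]
  simp only [mul_add, Finset.sum_add_distrib, Finset.mul_sum, mul_left_comm s]
  ring

lemma normSqCovDeriv_eq_innerCovDeriv (p : ι → ℝ) :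
    normSqCovDeriv g V p = innerCovDeriv g V V p := rfl

lemma innerCovDeriv_comm {p : ι → ℝ} (hsymm : (g p).IsSymm) :
    innerCovDeriv g V W p = innerCovDeriv g W V p := by
  unfold innerCovDeriv
  rw [Finset.sum_comm]
  refine Finset.sum_congr rfl fun i _ => Finset.sum_congr rfl fun j _ => ?_
  rw [Finset.sum_comm]
  refine Finset.sum_congr rfl fun k _ => Finset.sum_congr rfl fun l _ => ?_
  rw [hsymm.apply k l, hsymm.inv.apply i j]
  ring

lemma normSqCovDeriv_add_smul {p : ι → ℝ} (hsymm : (g p).IsSymm)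
    (hV : ∀ k, DifferentiableAt ℝ (fun q => V q k) p)
    (hW : ∀ k, DifferentiableAt ℝ (fun q => W q k) p) (s : ℝ) :
    normSqCovDeriv g (fun q => V q + s • W q) p
      = normSqCovDeriv g V p + (2 * s) * innerCovDeriv g W V p
        + s ^ 2 * normSqCovDeriv g W p := by
  have h : normSqCovDeriv g (fun q => V q + s • W q) p
      = innerCovDeriv g V V p + s * innerCovDeriv g V W p + s * innerCovDeriv g W V p
        + s ^ 2 * innerCovDeriv g W W p := by
    simp only [normSqCovDeriv, innerCovDeriv, covDeriv_add_smul hV hW, Finset.mul_sum,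
      ← Finset.sum_add_distrib]
    refine Finset.sum_congr rfl fun i _ => Finset.sum_congr rfl fun j _ =>
      Finset.sum_congr rfl fun k _ => Finset.sum_congr rfl fun l _ => ?_
    ring
  rw [h, innerCovDeriv_comm hsymm (V := V) (W := W)]
  simp only [normSqCovDeriv_eq_innerCovDeriv]
  ring

lemma innerCovDeriv_mul_sqrt_det (p : ι → ℝ) :
    innerCovDeriv g W V p * Real.sqrt (g p).det
      = ∑ i, ∑ k, momentum g V i k p * covDeriv g W i k p := by
  simp only [innerCovDeriv, momentum, Finset.sum_mul]
  refine Finset.sum_congr rfl fun i _ => ?_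
  rw [Finset.sum_comm]
  refine Finset.sum_congr rfl fun k _ => Finset.sum_congr rfl fun j _ =>
    Finset.sum_congr rfl fun l _ => ?_
  ring

/-- The energy over a compact `D` is exactly quadratic in `s`, so the derivative is read off as a
coefficient and no differentiation under the integral sign is needed. -/
lemma hasDerivAt_verticalEnergy (hU : IsOpen U)
    (hg : ∀ i j, ContDiffOn ℝ ∞ (fun p => g p i j) U)
    (hsymm : ∀ p ∈ U, (g p).IsSymm) (hdet : ∀ p ∈ U, 0 < (g p).det)
    (hV : ∀ k, ContDiffOn ℝ ∞ (fun p => V p k) U)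
    (hW : ∀ k, ContDiffOn ℝ ∞ (fun p => W p k) U)
    {D : Set (ι → ℝ)} (hD : IsCompact D) (hDU : D ⊆ U) :
    HasDerivAt (fun s : ℝ => verticalEnergy g D (fun p => V p + s • W p))
      (∫ p in D, innerCovDeriv g W V p * Real.sqrt (g p).det) 0 := by
  have hint : ∀ {X Y : (ι → ℝ) → ι → ℝ}, (∀ k, ContDiffOn ℝ ∞ (fun p => X p k) U) →
      (∀ k, ContDiffOn ℝ ∞ (fun p => Y p k) U) →
      IntegrableOn (fun p => innerCovDeriv g X Y p * Real.sqrt (g p).det) D := fun hX hY =>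
    (((contDiffOn_innerCovDeriv hU hg hdet hX hY).mul
      (contDiffOn_sqrt_det hg hdet)).continuousOn.mono hDU).integrableOn_compact hD
  have key : ∀ s : ℝ, verticalEnergy g D (fun p => V p + s • W p)
      = (1 / 2) * (∫ p in D, innerCovDeriv g V V p * Real.sqrt (g p).det)
        + s * (∫ p in D, innerCovDeriv g W V p * Real.sqrt (g p).det)
        + s ^ 2 * ((1 / 2) * ∫ p in D, innerCovDeriv g W W p * Real.sqrt (g p).det) := by
    intro s
    have h : ∫ p in D, normSqCovDeriv g (fun p => V p + s • W p) p * Real.sqrt (g p).det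
        = ∫ p in D, (innerCovDeriv g V V p * Real.sqrt (g p).det
          + (2 * s) * (innerCovDeriv g W V p * Real.sqrt (g p).det)
          + s ^ 2 * (innerCovDeriv g W W p * Real.sqrt (g p).det)) := by
      refine setIntegral_congr_fun hD.measurableSet fun p hp => ?_
      have hp' := hU.mem_nhds (hDU hp)
      simp only [normSqCovDeriv_add_smul (hsymm p (hDU hp))
        (fun k => ((hV k).contDiffAt hp').differentiableAt (by simp))
        (fun k => ((hW k).contDiffAt hp').differentiableAt (by simp)) s,
        normSqCovDeriv_eq_innerCovDeriv]
      ring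
    have hVW : IntegrableOn (fun p => innerCovDeriv g V V p * Real.sqrt (g p).det
        + (2 * s) * (innerCovDeriv g W V p * Real.sqrt (g p).det)) D :=
      (hint hV hV).add ((hint hW hV).const_mul _)
    rw [verticalEnergy, h, integral_add hVW
      ((hint hW hW).const_mul _), integral_add (hint hV hV) ((hint hW hV).const_mul _),
      integral_const_mul, integral_const_mul]
    ring
  rw [funext key]
  convert! (((hasDerivAt_id (0 : ℝ)).mul_const _).const_add _).add
    (((hasDerivAt_id (0 : ℝ)).pow 2).mul_const _) using 1
  simp

/-- Integration by parts against a smooth function with compact support in `D ⊆ U`. -/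
lemma setIntegral_mul_partialDeriv (hU : IsOpen U) {c w : (ι → ℝ) → ℝ}
    (hc : ContDiffOn ℝ ∞ c U) (hw : ContDiff ℝ ∞ w) {D : Set (ι → ℝ)} (hD : IsCompact D)
    (hDU : D ⊆ U) (hwD : tsupport w ⊆ D) (i : ι) :
    ∫ p in D, c p * partialDeriv i w p = - ∫ p in D, partialDeriv i c p * w p := by
  have hw0 : ∀ p, p ∉ D → w p = 0 := fun p hp => image_eq_zero_of_notMem_tsupport fun h => hp (hwD h)
  have hdw0 : ∀ p, p ∉ D → partialDeriv i w p = 0 := fun p hp =>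
    partialDeriv_eq_zero_of_notMem_tsupport (fun h => hp (hwD h)) i
  have hdw : ContDiffOn ℝ ∞ (partialDeriv i w) U := contDiffOn_partialDeriv hU hw.contDiffOn i
  have hdc : ContDiffOn ℝ ∞ (partialDeriv i c) U := contDiffOn_partialDeriv hU hc i
  have hint : ∀ {u v : (ι → ℝ) → ℝ}, ContDiffOn ℝ ∞ u U → ContDiffOn ℝ ∞ v U →
      (∀ p, p ∉ D → v p = 0) → Integrable (fun p => u p * v p) := fun hu hv hv0 =>
    (integrableOn_iff_integrable_of_support_subset (by
      intro p hp
      by_contra h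
      exact hp (by simp [hv0 p h]))).1
      (((hu.mul hv).continuousOn.mono hDU).integrableOn_compact hD)
  -- Both integrands vanish off `D`, so the integrals extend to the whole space, where no boundary
  -- term arises. Differentiability of `c` is needed only on the support of `w`, which lies in `U`.
  rw [setIntegral_eq_integral_of_forall_compl_eq_zero (fun p hp => by simp [hdw0 p hp]),
    setIntegral_eq_integral_of_forall_compl_eq_zero (fun p hp => by simp [hw0 p hp])]
  exact integral_mul_fderiv_eq_neg_fderiv_mul_of_integrable
    (hint hdc hw.contDiffOn hw0) (hint hc hdw hdw0) (hint hc hw.contDiffOn hw0)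
    (fun p hp => (hc.contDiffAt (hU.mem_nhds (hDU (hwD hp)))).differentiableAt (by simp))
    (fun p _ => hw.differentiable (by simp) p)

/-- In `∑ momentum * ∇W` the Christoffel part is already algebraic in `W`; only `∂_i W^m` has to be
integrated by parts against the momentum. The definition of `roughLaplacian` collects the resulting
coefficients of `W^m`. -/
lemma setIntegral_innerCovDeriv (hU : IsOpen U)
    (hg : ∀ i j, ContDiffOn ℝ ∞ (fun p => g p i j) U) (hdet : ∀ p ∈ U, 0 < (g p).det)
    (hV : ∀ k, ContDiffOn ℝ ∞ (fun p => V p k) U) (hW : ContDiff ℝ ∞ W)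
    {D : Set (ι → ℝ)} (hD : IsCompact D) (hDU : D ⊆ U) (hWD : tsupport W ⊆ D) :
    ∫ p in D, innerCovDeriv g W V p * Real.sqrt (g p).det
      = ∫ p in D, ∑ m, roughLaplacian g V m p * W p m := by
  have hWk : ∀ k, ContDiff ℝ ∞ (fun p => W p k) := fun k => contDiff_pi.1 hW k
  have hWkD : ∀ k, tsupport (fun p => W p k) ⊆ D := fun k =>
    (closure_mono fun p (hp : W p k ≠ 0) (h : W p = 0) => hp (by simp [h])).trans hWD
  have hP := contDiffOn_momentum hU hg hdet hV
  have hI : ∀ {u : (ι → ℝ) → ℝ}, ContDiffOn ℝ ∞ u U → IntegrableOn u D := fun hu =>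
    (hu.continuousOn.mono hDU).integrableOn_compact hD
  have h1 : ∀ i m, ContDiffOn ℝ ∞
      (fun p => momentum g V i m p * partialDeriv i (fun q => W q m) p) U := fun i m =>
    (hP i m).mul (contDiffOn_partialDeriv hU (hWk m).contDiffOn i)
  have h2 : ∀ i m, ContDiffOn ℝ ∞
      (fun p => partialDeriv i (momentum g V i m) p * W p m) U := fun i m =>
    (contDiffOn_partialDeriv hU (hP i m) i).mul (hWk m).contDiffOn
  have h3 : ∀ i m, ContDiffOn ℝ ∞
      (fun p => (∑ k, christoffel g k i m p * momentum g V i k p) * W p m) U := fun i m =>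
    (ContDiffOn.sum fun k _ => (contDiffOn_christoffel hU hg hdet k i m).mul (hP i k)).mul
      (hWk m).contDiffOn
  have hL : ∀ p, innerCovDeriv g W V p * Real.sqrt (g p).det
      = ∑ m, ∑ i, (momentum g V i m p * partialDeriv i (fun q => W q m) p
        + (∑ k, christoffel g k i m p * momentum g V i k p) * W p m) := by
    intro p
    rw [innerCovDeriv_mul_sqrt_det, Finset.sum_comm (s := Finset.univ (α := ι))]
    simp only [covDeriv, mul_add, Finset.sum_add_distrib, Finset.mul_sum, Finset.sum_mul]
    congr 1
    rw [Finset.sum_comm]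
    conv_rhs => rw [Finset.sum_comm]
    refine Finset.sum_congr rfl fun i _ => ?_
    rw [Finset.sum_comm]
    refine Finset.sum_congr rfl fun k _ => Finset.sum_congr rfl fun m _ => ?_
    ring
  have hR : ∀ p, ∑ m, roughLaplacian g V m p * W p m
      = ∑ m, ∑ i, ((∑ k, christoffel g k i m p * momentum g V i k p) * W p m
        - partialDeriv i (momentum g V i m) p * W p m) := by
    intro p
    simp only [roughLaplacian, Finset.sum_mul, sub_mul]
  simp only [hL, hR]
  rw [integral_finsetSum _ fun m _ => hI (ContDiffOn.sum fun i _ => (h1 i m).add (h3 i m)),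
    integral_finsetSum _ fun m _ => hI (ContDiffOn.sum fun i _ => (h3 i m).sub (h2 i m))]
  refine Finset.sum_congr rfl fun m _ => ?_
  rw [integral_finsetSum _ fun i _ => hI ((h1 i m).add (h3 i m)),
    integral_finsetSum _ fun i _ => hI ((h3 i m).sub (h2 i m))]
  refine Finset.sum_congr rfl fun i _ => ?_
  rw [integral_add (hI (h1 i m)) (hI (h3 i m)), integral_sub (hI (h3 i m)) (hI (h2 i m)),
    setIntegral_mul_partialDeriv hU (hP i m) (hWk m) hD hDU (hWkD m)]
  ring

/-- A vector field is harmonic if and only if its rough Laplacian vanishes. -/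
theorem isHarmonicField_iff_roughLaplacian_eq_zero (hU : IsOpen U)
    (hg : ∀ i j, ContDiffOn ℝ ∞ (fun p => g p i j) U)
    (hsymm : ∀ p ∈ U, (g p).IsSymm) (hdet : ∀ p ∈ U, 0 < (g p).det)
    (hV : ∀ k, ContDiffOn ℝ ∞ (fun p => V p k) U) :
    IsHarmonicField g U V ↔ ∀ p ∈ U, ∀ m, roughLaplacian g V m p = 0 := by
  have hderiv : ∀ {D : Set (ι → ℝ)}, IsCompact D → D ⊆ U → ∀ {W : (ι → ℝ) → ι → ℝ},
      ContDiff ℝ ∞ W → tsupport W ⊆ D →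
      HasDerivAt (fun s : ℝ => verticalEnergy g D (fun p => V p + s • W p))
        (∫ p in D, ∑ m, roughLaplacian g V m p * W p m) 0 := fun hD hDU _ hW hWD => by
    rw [← setIntegral_innerCovDeriv hU hg hdet hV hW hD hDU hWD]
    exact hasDerivAt_verticalEnergy hU hg hsymm hdet hV
      (fun k => (contDiff_pi.1 hW k).contDiffOn) hD hDU
  constructor
  · intro h p hp m
    have hR := (contDiffOn_roughLaplacian hU hg hdet hV m).continuousOn
    have hae : ∀ᵐ q, q ∈ U → roughLaplacian g V m q = 0 := by
      -- Test fields with the single component `w` in direction `m`, taking `D` to be the support of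
      -- `w`, isolate the `m`-th component of the Laplacian.
      refine hU.ae_eq_zero_of_integral_contDiff_smul_eq_zero
        (hR.locallyIntegrableOn hU.measurableSet) fun w hw hwc hwU => ?_
      have hW : ContDiff ℝ ∞ (fun q => Pi.single m (w q) : (ι → ℝ) → ι → ℝ) := by
        refine contDiff_pi.2 fun k => ?_
        by_cases hk : k = m
        · subst hk
          simpa using hw
        · simpa [Pi.single_eq_of_ne hk] using contDiff_const
      have hWD : tsupport (fun q => Pi.single m (w q) : (ι → ℝ) → ι → ℝ) ⊆ tsupport w :=
        closure_mono fun q (hq : (Pi.single m (w q) : ι → ℝ) ≠ 0) (h : w q = 0) => hq (by simp [h])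
      have h0 := (hderiv hwc.isCompact hwU hW hWD).unique
        (h _ hwc.isCompact hwU _ hW hWD)
      rw [← h0, setIntegral_eq_integral_of_forall_compl_eq_zero]
      · refine integral_congr_ae (Filter.Eventually.of_forall fun q => ?_)
        simp [Pi.single_apply, mul_comm]
      · intro q hq
        simp [image_eq_zero_of_notMem_tsupport hq]
    -- A continuous function vanishing almost everywhere on an open set vanishes there identically.
    exact Measure.eqOn_open_of_ae_eq ((ae_restrict_iff' hU.measurableSet).2 hae) hU hR
      continuousOn_const hp
  · intro h D hD hDU W hW hWD
    have h0 : ∫ p in D, ∑ m, roughLaplacian g V m p * W p m = 0 :=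
      setIntegral_eq_zero_of_forall_eq_zero fun p hp => by simp [h p (hDU hp)]
    simpa [h0] using hderiv hD hDU hW hWD

end General

/-! ### Separated functions on `I × ℝ³` -/

/-- The metric, the field and its momentum are all built from products of a function of `t` and a
function on the fibre, so this product rule supplies all their partial derivatives. -/
lemma hasFDerivAt_separated {u : ℝ → ℝ} {v : (Fin 3 → ℝ) → ℝ} {p : Fin 1 ⊕ Fin 3 → ℝ}
    (hu : DifferentiableAt ℝ u (p (Sum.inl 0))) (hv : DifferentiableAt ℝ v (p ∘ Sum.inr)) :
    HasFDerivAt (fun q : Fin 1 ⊕ Fin 3 → ℝ => u (q (Sum.inl 0)) * v (q ∘ Sum.inr))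
      (u (p (Sum.inl 0)) • (fderiv ℝ v (p ∘ Sum.inr)).comp
          (ContinuousLinearMap.pi fun j => ContinuousLinearMap.proj (Sum.inr j))
        + v (p ∘ Sum.inr) • deriv u (p (Sum.inl 0)) •
          (ContinuousLinearMap.proj (Sum.inl 0) : (Fin 1 ⊕ Fin 3 → ℝ) →L[ℝ] ℝ)) p := by
  have h1 : HasFDerivAt (fun q : Fin 1 ⊕ Fin 3 → ℝ => u (q (Sum.inl 0)))
      (deriv u (p (Sum.inl 0)) •
        (ContinuousLinearMap.proj (Sum.inl 0) : (Fin 1 ⊕ Fin 3 → ℝ) →L[ℝ] ℝ)) p :=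
    hu.hasDerivAt.comp_hasFDerivAt p
      (ContinuousLinearMap.proj (R := ℝ) (φ := fun _ : Fin 1 ⊕ Fin 3 => ℝ)
        (Sum.inl 0)).hasFDerivAt
  have h2 : HasFDerivAt (fun q : Fin 1 ⊕ Fin 3 → ℝ => v (q ∘ Sum.inr))
      ((fderiv ℝ v (p ∘ Sum.inr)).comp
        (ContinuousLinearMap.pi fun j => ContinuousLinearMap.proj (Sum.inr j))) p :=
    HasFDerivAt.comp p (f := fun q : Fin 1 ⊕ Fin 3 → ℝ => q ∘ Sum.inr) hv.hasFDerivAt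
      (ContinuousLinearMap.hasFDerivAt (ContinuousLinearMap.pi fun j : Fin 3 =>
        ContinuousLinearMap.proj (R := ℝ) (φ := fun _ : Fin 1 ⊕ Fin 3 => ℝ) (Sum.inr j)))
  exact h1.mul h2

lemma partialDeriv_inl_separated {u : ℝ → ℝ} {v : (Fin 3 → ℝ) → ℝ} {p : Fin 1 ⊕ Fin 3 → ℝ}
    (hu : DifferentiableAt ℝ u (p (Sum.inl 0))) (hv : DifferentiableAt ℝ v (p ∘ Sum.inr)) :
    partialDeriv (Sum.inl 0)
      (fun q : Fin 1 ⊕ Fin 3 → ℝ => u (q (Sum.inl 0)) * v (q ∘ Sum.inr)) p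
      = deriv u (p (Sum.inl 0)) * v (p ∘ Sum.inr) := by
  rw [partialDeriv, (hasFDerivAt_separated hu hv).fderiv]
  have h : (ContinuousLinearMap.pi fun j : Fin 3 => ContinuousLinearMap.proj (R := ℝ)
      (φ := fun _ : Fin 1 ⊕ Fin 3 => ℝ) (Sum.inr j)) (Pi.single (Sum.inl 0) 1) = 0 := by
    ext j
    simp
  simp [h, mul_comm]

lemma partialDeriv_inr_separated {u : ℝ → ℝ} {v : (Fin 3 → ℝ) → ℝ} {p : Fin 1 ⊕ Fin 3 → ℝ}
    (hu : DifferentiableAt ℝ u (p (Sum.inl 0))) (hv : DifferentiableAt ℝ v (p ∘ Sum.inr))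
    (j : Fin 3) :
    partialDeriv (Sum.inr j)
      (fun q : Fin 1 ⊕ Fin 3 → ℝ => u (q (Sum.inl 0)) * v (q ∘ Sum.inr)) p
      = u (p (Sum.inl 0)) * partialDeriv j v (p ∘ Sum.inr) := by
  rw [partialDeriv, (hasFDerivAt_separated hu hv).fderiv]
  have h : (ContinuousLinearMap.pi fun j : Fin 3 => ContinuousLinearMap.proj (R := ℝ)
      (φ := fun _ : Fin 1 ⊕ Fin 3 => ℝ) (Sum.inr j)) (Pi.single (Sum.inr j) 1)
      = Pi.single j 1 := by
    ext k
    simp [Pi.single_apply]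
  simp [h, partialDeriv]

lemma partialDeriv_const {ι : Type*} [DecidableEq ι] (i : ι) (c : ℝ) (p : ι → ℝ) :
    partialDeriv i (fun _ => c) p = 0 := by
  simp [partialDeriv]

lemma partialDeriv_mul {ι : Type*} [Fintype ι] [DecidableEq ι] {i : ι} {u v : (ι → ℝ) → ℝ}
    {p : ι → ℝ} (hu : DifferentiableAt ℝ u p) (hv : DifferentiableAt ℝ v p) :
    partialDeriv i (fun q => u q * v q) p
      = partialDeriv i u p * v p + u p * partialDeriv i v p := by
  simp [partialDeriv, fderiv_fun_mul hu hv]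
  ring

lemma partialDeriv_apply {ι : Type*} [Fintype ι] [DecidableEq ι] (i j : ι) (p : ι → ℝ) :
    partialDeriv i (fun q => q j) p = if j = i then 1 else 0 := by
  have h : HasFDerivAt (fun q : ι → ℝ => q j)
    (ContinuousLinearMap.proj j : (ι → ℝ) →L[ℝ] ℝ) p :=
    (ContinuousLinearMap.proj (R := ℝ) (φ := fun _ : ι => ℝ) j).hasFDerivAt
  simp [partialDeriv, h.fderiv, Pi.single_apply]

/-! ### The metric of `I ×_f ℍ³` -/

variable {I : Set ℝ} {f φ : ℝ → ℝ} {a : (Fin 3 → ℝ) → ℝ} {p : Fin 1 ⊕ Fin 3 → ℝ}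

lemma heisenbergMetric_apply (q : Fin 3 → ℝ) (i j : Fin 3) :
    heisenbergMetric q i j
      = (!![1, 0, 0; 0, 1, -q 0; 0, -q 0, 1 + q 0 ^ 2] : Matrix (Fin 3) (Fin 3) ℝ) i j := rfl

lemma contDiff_heisenbergMetric (i j : Fin 3) :
    ContDiff ℝ ∞ (fun q => heisenbergMetric q i j) := by
  fin_cases i <;> fin_cases j <;> simp [heisenbergMetric] <;> fun_prop

lemma partialDeriv_heisenbergMetric (l i j : Fin 3) (q : Fin 3 → ℝ) :
    partialDeriv l (fun q => heisenbergMetric q i j) q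
      = if l = 0 then (!![0, 0, 0; 0, 0, -1; 0, -1, 2 * q 0] : Matrix (Fin 3) (Fin 3) ℝ) i j
        else 0 := by
  have h0 : ∀ c : ℝ, partialDeriv l (fun _ => c) q = 0 := fun c => partialDeriv_const l c q
  have h1 : partialDeriv l (fun q => -q 0) q = if l = 0 then -1 else 0 := by
    have := partialDeriv_const_mul (i := l) (-1) (u := fun q : Fin 3 → ℝ => q 0) (p := q)
      (by fun_prop)
    simp only [neg_one_mul] at this
    rw [this, partialDeriv_apply]
    simp only [eq_comm (a := l)]
    split_ifs <;> simp
  have h2 : partialDeriv l (fun q => 1 + q 0 ^ 2) q = if l = 0 then 2 * q 0 else 0 := by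
    simp only [pow_two]
    rw [partialDeriv_add (u := fun _ => (1 : ℝ)) (v := fun q : Fin 3 → ℝ => q 0 * q 0)
      (by fun_prop) (by fun_prop),
      h0, partialDeriv_mul (u := fun q : Fin 3 → ℝ => q 0) (v := fun q : Fin 3 → ℝ => q 0)
      (by fun_prop) (by fun_prop), partialDeriv_apply]
    simp only [eq_comm (a := l)]
    split_ifs
    · simp
      ring
    · simp
  fin_cases i <;> fin_cases j <;> simp [heisenbergMetric, h0, h1, h2]

lemma heisenbergWarpedMetric_inr_inr (i j : Fin 3) :
    heisenbergWarpedMetric f p (Sum.inr i) (Sum.inr j)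
      = f (p (Sum.inl 0)) ^ 2 * heisenbergMetric (p ∘ Sum.inr) i j := rfl

lemma heisenbergWarpedMetric_inl_inr (i : Fin 1) (j : Fin 3) :
    heisenbergWarpedMetric f p (Sum.inl i) (Sum.inr j) = 0 := rfl

lemma heisenbergWarpedMetric_inr_inl (i : Fin 3) (j : Fin 1) :
    heisenbergWarpedMetric f p (Sum.inr i) (Sum.inl j) = 0 := rfl

lemma heisenbergWarpedMetric_inl_inl (i j : Fin 1) :
    heisenbergWarpedMetric f p (Sum.inl i) (Sum.inl j) = 1 := by
  fin_cases i
  fin_cases j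
  simp [heisenbergWarpedMetric, warpedMetric]

lemma isSymm_heisenbergWarpedMetric : (heisenbergWarpedMetric f p).IsSymm := by
  refine Matrix.IsSymm.ext fun i j => ?_
  rcases i with i | i <;> rcases j with j | j
  · rw [heisenbergWarpedMetric_inl_inl, heisenbergWarpedMetric_inl_inl]
  · rfl
  · rfl
  · rw [heisenbergWarpedMetric_inr_inr, heisenbergWarpedMetric_inr_inr]
    fin_cases i <;> fin_cases j <;> simp [heisenbergMetric]

/-- The Heisenberg matrix has determinant 1. The result is kept as a square so that its root is `f ^
3` when `f > 0`. -/
lemma det_heisenbergWarpedMetric :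
    (heisenbergWarpedMetric f p).det = (f (p (Sum.inl 0)) ^ 3) ^ 2 := by
  have h : (heisenbergMetric (p ∘ Sum.inr)).det = 1 := by
    simp [heisenbergMetric, Matrix.det_fin_three]
    ring
  rw [heisenbergWarpedMetric, warpedMetric, Matrix.det_fromBlocks_zero₂₁, Matrix.det_one,
    Matrix.det_smul, h]
  simp
  ring

/-- The fibre block is `f⁻² ∑ e_i ⊗ e_i` for the left-invariant orthonormal frame `∂_x`, `∂_y`, `∂_z
+ x ∂_y`. -/
lemma inv_heisenbergWarpedMetric (hf : f (p (Sum.inl 0)) ≠ 0) :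
    (heisenbergWarpedMetric f p)⁻¹ = Matrix.fromBlocks 1 0 0
      ((f (p (Sum.inl 0)) ^ 2)⁻¹ • !![1, 0, 0; 0, 1 + p (Sum.inr 0) ^ 2, p (Sum.inr 0);
        0, p (Sum.inr 0), 1]) := by
  apply Matrix.inv_eq_right_inv
  have h : heisenbergMetric (p ∘ Sum.inr) * !![1, 0, 0; 0, 1 + p (Sum.inr 0) ^ 2, p (Sum.inr 0);
        0, p (Sum.inr 0), 1] = 1 := by
    ext i j
    fin_cases i <;> fin_cases j <;>
      simp [heisenbergMetric, Matrix.mul_apply, Fin.sum_univ_three] <;> ring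
  rw [heisenbergWarpedMetric, warpedMetric, Matrix.fromBlocks_multiply,
    Matrix.smul_mul (f ((p ∘ Sum.inl) 0) ^ 2) (heisenbergMetric (p ∘ Sum.inr)) (_ • _),
    Matrix.mul_smul (heisenbergMetric (p ∘ Sum.inr)), h]
  simp [smul_smul, hf, Matrix.fromBlocks_one]

lemma contDiffOn_separated {u : ℝ → ℝ} {v : (Fin 3 → ℝ) → ℝ} (hu : ContDiffOn ℝ ∞ u I)
    (hv : ContDiff ℝ ∞ v) :
    ContDiffOn ℝ ∞ (fun q : Fin 1 ⊕ Fin 3 → ℝ => u (q (Sum.inl 0)) * v (q ∘ Sum.inr))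
      (warpedDomain I) := by
  refine ContDiffOn.mul (hu.comp (contDiff_apply ℝ ℝ _).contDiffOn fun _ h => h)
    (hv.comp ?_).contDiffOn
  exact contDiff_pi.2 fun j => contDiff_apply ℝ ℝ (Sum.inr j)

lemma contDiffOn_heisenbergWarpedMetric (hf : ContDiffOn ℝ ∞ f I) (i j : Fin 1 ⊕ Fin 3) :
    ContDiffOn ℝ ∞ (fun p => heisenbergWarpedMetric f p i j) (warpedDomain I) := by
  rcases i with i | i <;> rcases j with j | j
  · simpa only [heisenbergWarpedMetric_inl_inl] using contDiffOn_const
  · exact contDiffOn_const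
  · exact contDiffOn_const
  · exact contDiffOn_separated (hf.pow 2) (contDiff_heisenbergMetric i j)

lemma isOpen_warpedDomain (hI : IsOpen I) : IsOpen (warpedDomain I) :=
  hI.preimage (continuous_apply (Sum.inl 0))

lemma partialDeriv_inl_heisenbergWarpedMetric (hf : DifferentiableAt ℝ f (p (Sum.inl 0)))
    (i j : Fin 3) :
    partialDeriv (Sum.inl 0) (fun q => heisenbergWarpedMetric f q (Sum.inr i) (Sum.inr j)) p
      = 2 * f (p (Sum.inl 0)) * deriv f (p (Sum.inl 0)) * heisenbergMetric (p ∘ Sum.inr) i j := by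
  simp only [heisenbergWarpedMetric_inr_inr]
  rw [partialDeriv_inl_separated (u := fun t => f t ^ 2)
    (v := fun q => heisenbergMetric q i j) (hf.pow 2)
    ((contDiff_heisenbergMetric i j).differentiable (by simp) _), deriv_fun_pow hf 2]
  simp

lemma partialDeriv_inr_heisenbergWarpedMetric (hf : DifferentiableAt ℝ f (p (Sum.inl 0)))
    (l i j : Fin 3) :
    partialDeriv (Sum.inr l) (fun q => heisenbergWarpedMetric f q (Sum.inr i) (Sum.inr j)) p
      = f (p (Sum.inl 0)) ^ 2 * if l = 0 then
        (!![0, 0, 0; 0, 0, -1; 0, -1, 2 * p (Sum.inr 0)] : Matrix (Fin 3) (Fin 3) ℝ) i j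
        else 0 := by
  simp only [heisenbergWarpedMetric_inr_inr]
  rw [partialDeriv_inr_separated (u := fun t => f t ^ 2)
    (v := fun q => heisenbergMetric q i j) (hf.pow 2)
    ((contDiff_heisenbergMetric i j).differentiable (by simp) _), partialDeriv_heisenbergMetric]
  rfl

/-- The Christoffel symbols of `dt² + f² (dx² + (dy - x dz)² + dz²)` at a point where `f` has the
value `r` and the derivative `r'`. -/
def heisenbergChristoffel (r r' x : ℝ) (k i j : Fin 1 ⊕ Fin 3) : ℝ :=
  match k, i, j with
  | Sum.inl _, Sum.inr i, Sum.inr j =>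
    -(r * r') * (!![1, 0, 0; 0, 1, -x; 0, -x, 1 + x ^ 2] : Matrix (Fin 3) (Fin 3) ℝ) i j
  | Sum.inr k, Sum.inl _, Sum.inr j => if j = k then r' / r else 0
  | Sum.inr k, Sum.inr i, Sum.inl _ => if i = k then r' / r else 0
  | Sum.inr k, Sum.inr i, Sum.inr j =>
    (![!![0, 0, 0; 0, 0, 1 / 2; 0, 1 / 2, -x],
      !![0, -x / 2, (x ^ 2 - 1) / 2; -x / 2, 0, 0; (x ^ 2 - 1) / 2, 0, 0],
      !![0, -1 / 2, x / 2; -1 / 2, 0, 0; x / 2, 0, 0]] : Fin 3 → Matrix (Fin 3) (Fin 3) ℝ) k i j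
  | _, _, _ => 0

/-- These are the usual warped product formulas: `-f f' g_ℍ` in the base direction, `f'/f` in the
mixed entries, and the symbols of `ℍ³` itself in the fibre, where `f²` cancels against its inverse.
-/
lemma christoffel_heisenbergWarpedMetric (hf : DifferentiableAt ℝ f (p (Sum.inl 0)))
    (hf0 : f (p (Sum.inl 0)) ≠ 0) (k i j : Fin 1 ⊕ Fin 3) :
    christoffel (heisenbergWarpedMetric f) k i j p
      = heisenbergChristoffel (f (p (Sum.inl 0))) (deriv f (p (Sum.inl 0))) (p (Sum.inr 0))
        k i j := by
  unfold christoffel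
  rw [inv_heisenbergWarpedMetric hf0]
  simp only [Fintype.sum_sum_type, Fin.sum_univ_three, Finset.univ_unique, Fin.default_eq_zero,
    Finset.sum_singleton]
  rcases k with k | k <;> rcases i with i | i <;> rcases j with j | j <;>
    fin_cases k <;> fin_cases i <;> fin_cases j <;>
    simp [partialDeriv_inl_heisenbergWarpedMetric hf, partialDeriv_inr_heisenbergWarpedMetric hf,
      heisenbergWarpedMetric_inl_inl, heisenbergWarpedMetric_inl_inr,
      heisenbergWarpedMetric_inr_inl, partialDeriv_const, heisenbergMetric_apply,
      heisenbergChristoffel] <;>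
    field_simp <;> ring

/-! ### The rough Laplacian of `φ ∂_t + a e₁` -/

lemma heisenbergField_inl (i : Fin 1) :
    heisenbergField φ a p (Sum.inl i) = φ (p (Sum.inl 0)) := rfl

lemma heisenbergField_inr (i : Fin 3) :
    heisenbergField φ a p (Sum.inr i) = if i = 0 then a (p ∘ Sum.inr) else 0 := by
  fin_cases i <;> simp [heisenbergField, sumField, heisenbergE₁]

/-- The derivative at `p` of a function that has the form `α(t) + β(t) v(x, y, z)` on an open
set. -/
lemma partialDeriv_inl_eq_of_separated {U : Set (Fin 1 ⊕ Fin 3 → ℝ)} (hU : IsOpen U)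
    {M : (Fin 1 ⊕ Fin 3 → ℝ) → ℝ} {α β : ℝ → ℝ} {v : (Fin 3 → ℝ) → ℝ} {α' β' : ℝ}
    (hα : HasDerivAt α α' (p (Sum.inl 0))) (hβ : HasDerivAt β β' (p (Sum.inl 0)))
    (hv : Differentiable ℝ v)
    (hM : ∀ q ∈ U, M q = α (q (Sum.inl 0)) + β (q (Sum.inl 0)) * v (q ∘ Sum.inr)) (hp : p ∈ U) :
    partialDeriv (Sum.inl 0) M p = α' + β' * v (p ∘ Sum.inr) := by
  -- Writing `α` as `α · 1` makes it a separated product too.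
  have hα1 : DifferentiableAt ℝ
      (fun q : Fin 1 ⊕ Fin 3 → ℝ => α (q (Sum.inl 0)) * (fun _ => (1 : ℝ)) (q ∘ Sum.inr)) p :=
    (hasFDerivAt_separated hα.differentiableAt (differentiableAt_const 1)).differentiableAt
  rw [partialDeriv_congr_on hU
      (v := fun q => α (q (Sum.inl 0)) * (fun _ => (1 : ℝ)) (q ∘ Sum.inr)
        + β (q (Sum.inl 0)) * v (q ∘ Sum.inr)) (fun q hq => by simp [hM q hq]) hp,
    partialDeriv_add hα1 (hasFDerivAt_separated hβ.differentiableAt (hv _)).differentiableAt,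
    partialDeriv_inl_separated hα.differentiableAt (differentiableAt_const 1),
    partialDeriv_inl_separated hβ.differentiableAt (hv _), hα.deriv, hβ.deriv, mul_one]

/-- The term `α` is constant along the fibre and drops out. The separated form is required only on
an open set because the momentum is known explicitly only over `I`. -/
lemma partialDeriv_inr_eq_of_separated {U : Set (Fin 1 ⊕ Fin 3 → ℝ)} (hU : IsOpen U)
    {M : (Fin 1 ⊕ Fin 3 → ℝ) → ℝ} {α β : ℝ → ℝ} {v : (Fin 3 → ℝ) → ℝ}
    (hα : DifferentiableAt ℝ α (p (Sum.inl 0))) (hβ : DifferentiableAt ℝ β (p (Sum.inl 0)))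
    (hv : Differentiable ℝ v)
    (hM : ∀ q ∈ U, M q = α (q (Sum.inl 0)) + β (q (Sum.inl 0)) * v (q ∘ Sum.inr)) (hp : p ∈ U)
    (j : Fin 3) :
    partialDeriv (Sum.inr j) M p = β (p (Sum.inl 0)) * partialDeriv j v (p ∘ Sum.inr) := by
  have hα1 : DifferentiableAt ℝ
      (fun q : Fin 1 ⊕ Fin 3 → ℝ => α (q (Sum.inl 0)) * (fun _ => (1 : ℝ)) (q ∘ Sum.inr)) p :=
    (hasFDerivAt_separated hα (differentiableAt_const 1)).differentiableAt
  rw [partialDeriv_congr_on hU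
      (v := fun q => α (q (Sum.inl 0)) * (fun _ => (1 : ℝ)) (q ∘ Sum.inr)
        + β (q (Sum.inl 0)) * v (q ∘ Sum.inr)) (fun q hq => by simp [hM q hq]) hp,
    partialDeriv_add hα1 (hasFDerivAt_separated hβ (hv _)).differentiableAt,
    partialDeriv_inr_separated hα (differentiableAt_const 1),
    partialDeriv_inr_separated hβ (hv _), partialDeriv_const, mul_zero, zero_add]

/-- The components `(∇_{∂_i} V)^k` of `V = φ ∂_t + a e₁`, from the values `r`, `r'` of `f`, `f'`,
the values `s`, `s'` of `φ`, `φ'`, the value `c` of `a` and its partial derivatives `b`. -/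
def heisenbergCovDeriv (r r' s s' x c : ℝ) (b : Fin 3 → ℝ) (i k : Fin 1 ⊕ Fin 3) : ℝ :=
  match i, k with
  | Sum.inl _, Sum.inl _ => s'
  | Sum.inl _, Sum.inr k => if k = 0 then c * (r' / r) else 0
  | Sum.inr i, Sum.inl _ => if i = 0 then -(c * r * r') else 0
  | Sum.inr i, Sum.inr k =>
    (!![s * (r' / r) + b 0, 0, 0;
      b 1, s * (r' / r) - c * x / 2, -c / 2;
      b 2, c * (x ^ 2 - 1) / 2, s * (r' / r) + c * x / 2] : Matrix (Fin 3) (Fin 3) ℝ) i k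

lemma covDeriv_heisenbergField (hf : DifferentiableAt ℝ f (p (Sum.inl 0)))
    (hf0 : f (p (Sum.inl 0)) ≠ 0) (hφ : DifferentiableAt ℝ φ (p (Sum.inl 0)))
    (ha : Differentiable ℝ a) (i k : Fin 1 ⊕ Fin 3) :
    covDeriv (heisenbergWarpedMetric f) (heisenbergField φ a) i k p
      = heisenbergCovDeriv (f (p (Sum.inl 0))) (deriv f (p (Sum.inl 0))) (φ (p (Sum.inl 0)))
        (deriv φ (p (Sum.inl 0))) (p (Sum.inr 0)) (a (p ∘ Sum.inr))
        (fun j => partialDeriv j a (p ∘ Sum.inr)) i k := by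
  -- The components `φ` and `a` are the separated forms with `α = φ`, `β = 0` and with `α = 0`, `β =
  -- 1`.
  have hφ1 : partialDeriv (Sum.inl 0) (fun q : Fin 1 ⊕ Fin 3 → ℝ => φ (q (Sum.inl 0))) p
      = deriv φ (p (Sum.inl 0)) := by
    have := partialDeriv_inl_eq_of_separated isOpen_univ hφ.hasDerivAt (hasDerivAt_const _ 0)
      (differentiable_const 0) (M := fun q : Fin 1 ⊕ Fin 3 → ℝ => φ (q (Sum.inl 0)))
      (by simp) (Set.mem_univ p)
    simpa using this
  have hφ2 : ∀ j, partialDeriv (Sum.inr j)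
      (fun q : Fin 1 ⊕ Fin 3 → ℝ => φ (q (Sum.inl 0))) p = 0 := fun j => by
    have := partialDeriv_inr_eq_of_separated isOpen_univ hφ (differentiableAt_const 0)
      (differentiable_const 0) (M := fun q : Fin 1 ⊕ Fin 3 → ℝ => φ (q (Sum.inl 0)))
      (by simp) (Set.mem_univ p) j
    simpa using this
  have ha1 : partialDeriv (Sum.inl 0) (fun q : Fin 1 ⊕ Fin 3 → ℝ => a (q ∘ Sum.inr)) p = 0 := by
    have := partialDeriv_inl_eq_of_separated isOpen_univ (hasDerivAt_const _ 0)
      (hasDerivAt_const _ 1) ha (M := fun q : Fin 1 ⊕ Fin 3 → ℝ => a (q ∘ Sum.inr))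
      (by simp) (Set.mem_univ p)
    simpa using this
  have ha2 : ∀ j, partialDeriv (Sum.inr j) (fun q : Fin 1 ⊕ Fin 3 → ℝ => a (q ∘ Sum.inr)) p
      = partialDeriv j a (p ∘ Sum.inr) := fun j => by
    have := partialDeriv_inr_eq_of_separated isOpen_univ (differentiableAt_const 0)
      (differentiableAt_const 1) ha (M := fun q : Fin 1 ⊕ Fin 3 → ℝ => a (q ∘ Sum.inr))
      (by simp) (Set.mem_univ p) j
    simpa using this
  simp only [covDeriv, Fintype.sum_sum_type, Fin.sum_univ_three, Finset.univ_unique,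
    Fin.default_eq_zero, Finset.sum_singleton, christoffel_heisenbergWarpedMetric hf hf0]
  rcases i with i | i <;> rcases k with k | k <;> fin_cases i <;> fin_cases k <;>
    simp [heisenbergField_inl, heisenbergField_inr, hφ1, hφ2, ha1, ha2, partialDeriv_const,
      heisenbergChristoffel, heisenbergCovDeriv] <;> ring

/-- The components `√(det g) g^{ij} g_{kl} (∇_j V)^l` of `V = φ ∂_t + a e₁`, with the notation of
`heisenbergCovDeriv`. -/
def heisenbergMomentum (r r' s s' x c : ℝ) (b : Fin 3 → ℝ) (i k : Fin 1 ⊕ Fin 3) : ℝ :=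
  match i, k with
  | Sum.inl _, Sum.inl _ => r ^ 3 * s'
  | Sum.inl _, Sum.inr k => if k = 0 then r ^ 4 * r' * c else 0
  | Sum.inr i, Sum.inl _ => if i = 0 then -(r ^ 2 * r') * c else 0
  | Sum.inr i, Sum.inr k =>
    (!![r ^ 2 * r' * s + r ^ 3 * b 0, 0, 0;
      r ^ 3 * ((1 + x ^ 2) * b 1 + x * b 2), r ^ 2 * r' * s + r ^ 3 * (-(c * x) / 2),
        r ^ 3 * (c * (x ^ 2 - 1) / 2);
      r ^ 3 * (x * b 1 + b 2), r ^ 3 * (-c / 2), r ^ 2 * r' * s + r ^ 3 * (c * x / 2)] :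
        Matrix (Fin 3) (Fin 3) ℝ) i k

lemma momentum_heisenbergField (hf : DifferentiableAt ℝ f (p (Sum.inl 0)))
    (hf0 : 0 < f (p (Sum.inl 0))) (hφ : DifferentiableAt ℝ φ (p (Sum.inl 0)))
    (ha : Differentiable ℝ a) (i k : Fin 1 ⊕ Fin 3) :
    momentum (heisenbergWarpedMetric f) (heisenbergField φ a) i k p
      = heisenbergMomentum (f (p (Sum.inl 0))) (deriv f (p (Sum.inl 0))) (φ (p (Sum.inl 0)))
        (deriv φ (p (Sum.inl 0))) (p (Sum.inr 0)) (a (p ∘ Sum.inr))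
        (fun j => partialDeriv j a (p ∘ Sum.inr)) i k := by
  have hne := hf0.ne'
  simp only [momentum, Fintype.sum_sum_type, Fin.sum_univ_three, Finset.univ_unique,
    Fin.default_eq_zero, Finset.sum_singleton, covDeriv_heisenbergField hf hne hφ ha,
    det_heisenbergWarpedMetric, Real.sqrt_sq (pow_pos hf0 3).le, inv_heisenbergWarpedMetric hne]
  rcases i with i | i <;> rcases k with k | k <;> fin_cases i <;> fin_cases k <;>
    simp [heisenbergWarpedMetric_inl_inl, heisenbergWarpedMetric_inl_inr,
      heisenbergWarpedMetric_inr_inl, heisenbergWarpedMetric_inr_inr, heisenbergMetric_apply,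
      heisenbergCovDeriv, heisenbergMomentum] <;>
    field_simp <;> ring

lemma contDiff_partialDeriv {ι : Type*} [Fintype ι] [DecidableEq ι] {u : (ι → ℝ) → ℝ}
    (hu : ContDiff ℝ ∞ u) (i : ι) : ContDiff ℝ ∞ (partialDeriv i u) :=
  contDiffOn_univ.1 (contDiffOn_partialDeriv isOpen_univ hu.contDiffOn i)

lemma contDiffOn_heisenbergField (hφ : ContDiffOn ℝ ∞ φ I) (ha : ContDiff ℝ ∞ a)
    (k : Fin 1 ⊕ Fin 3) :
    ContDiffOn ℝ ∞ (fun p => heisenbergField φ a p k) (warpedDomain I) := by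
  rcases k with k | k
  · simpa [heisenbergField_inl] using
      contDiffOn_separated hφ (contDiff_const (c := (1 : ℝ)) (E := Fin 3 → ℝ))
  · simp only [heisenbergField_inr]
    split_ifs
    · simpa using contDiffOn_separated (contDiffOn_const (c := (1 : ℝ)) (s := I)) ha
    · exact contDiffOn_const

lemma hasDerivAt_deriv_of_contDiffOn (hI : IsOpen I) {u : ℝ → ℝ} (hu : ContDiffOn ℝ ∞ u I)
    {t : ℝ} (ht : t ∈ I) :
    HasDerivAt u (deriv u t) t ∧ HasDerivAt (deriv u) (deriv (deriv u) t) t :=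
  ⟨((hu.differentiableOn (by simp)).differentiableAt (hI.mem_nhds ht)).hasDerivAt,
    (((hu.deriv_of_isOpen (m := ∞) hI (by simp)).differentiableOn (by simp)).differentiableAt
      (hI.mem_nhds ht)).hasDerivAt⟩

lemma momentum_heisenbergField_of_mem (hI : IsOpen I) (hf : ContDiffOn ℝ ∞ f I)
    (hfpos : ∀ t ∈ I, 0 < f t) (hφ : ContDiffOn ℝ ∞ φ I) (ha : ContDiff ℝ ∞ a)
    (hp : p ∈ warpedDomain I) (i k : Fin 1 ⊕ Fin 3) :
    momentum (heisenbergWarpedMetric f) (heisenbergField φ a) i k p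
      = heisenbergMomentum (f (p (Sum.inl 0))) (deriv f (p (Sum.inl 0))) (φ (p (Sum.inl 0)))
        (deriv φ (p (Sum.inl 0))) (p (Sum.inr 0)) (a (p ∘ Sum.inr))
        (fun j => partialDeriv j a (p ∘ Sum.inr)) i k :=
  momentum_heisenbergField (hasDerivAt_deriv_of_contDiffOn hI hf hp).1.differentiableAt
    (hfpos _ hp) (hasDerivAt_deriv_of_contDiffOn hI hφ hp).1.differentiableAt
    (ha.differentiable (by simp)) i k

/-- Serves to pull the coefficients in `x` out of the `y` and `z` derivatives of the momentum. -/
lemma partialDeriv_comp_apply_mul {ι : Type*} [Fintype ι] [DecidableEq ι] {i j : ι} (hij : j ≠ i)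
    {c : ℝ → ℝ} (hc : Differentiable ℝ c) {u : (ι → ℝ) → ℝ} (hu : Differentiable ℝ u)
    (q : ι → ℝ) :
    partialDeriv i (fun q => c (q j) * u q) q = c (q j) * partialDeriv i u q := by
  have h : HasFDerivAt (fun q : ι → ℝ => c (q j))
      (deriv c (q j) • (ContinuousLinearMap.proj j : (ι → ℝ) →L[ℝ] ℝ)) q :=
    (hc (q j)).hasDerivAt.comp_hasFDerivAt q
      (ContinuousLinearMap.proj (R := ℝ) (φ := fun _ : ι => ℝ) j).hasFDerivAt
  rw [partialDeriv_mul h.differentiableAt (hu q)]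
  simp [partialDeriv, h.fderiv, hij]

/-- In the `x` component the second-order part is the Laplacian `e₁² + e₂² + e₃²` of `ℍ³` acting on
`a`, and the constant `1/2` is the eigenvalue in `∇^*∇ e₁ = e₁ / 2` on `ℍ³`. The `y` and `z`
components together are the covector `f³ (e₃(a) (dy - x dz) + e₂(a) dz)`. -/
lemma roughLaplacian_heisenbergField (hI : IsOpen I) (hf : ContDiffOn ℝ ∞ f I)
    (hfpos : ∀ t ∈ I, 0 < f t) (hφ : ContDiffOn ℝ ∞ φ I) (ha : ContDiff ℝ ∞ a)
    (hp : p ∈ warpedDomain I) {t : ℝ} {q : Fin 3 → ℝ} (ht : p (Sum.inl 0) = t)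
    (hq : p ∘ Sum.inr = q) (m : Fin 1 ⊕ Fin 3) :
    roughLaplacian (heisenbergWarpedMetric f) (heisenbergField φ a) m p
      = Sum.elim (fun _ => f t ^ 3 * (2 * partialDeriv 0 a q * (deriv f t / f t)
            - (deriv (deriv φ) t + 3 * (deriv f t / f t) * deriv φ t
              - 3 * (deriv f t / f t) ^ 2 * φ t)))
          ![f t ^ 3 * (a q * (1 / 2 - (f t * deriv (deriv f) t + 2 * deriv f t ^ 2))
              - (partialDeriv 0 (partialDeriv 0 a) q
                + ((1 + q 0 ^ 2) * partialDeriv 1 (partialDeriv 1 a) q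
                  + q 0 * partialDeriv 1 (partialDeriv 2 a) q)
                + (q 0 * partialDeriv 2 (partialDeriv 1 a) q
                  + partialDeriv 2 (partialDeriv 2 a) q))),
            f t ^ 3 * (q 0 * partialDeriv 1 a q + partialDeriv 2 a q),
            f t ^ 3 * (partialDeriv 1 a q
              - q 0 * (q 0 * partialDeriv 1 a q + partialDeriv 2 a q))] m := by
  have hU := isOpen_warpedDomain hI
  have hM := fun {p} => momentum_heisenbergField_of_mem (p := p) hI hf hfpos hφ ha
  have hne : f t ≠ 0 := ht ▸ (hfpos _ hp).ne'
  have hx : p (Sum.inr 0) = q 0 := hq ▸ rfl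
  obtain ⟨hf1, hf2⟩ := hasDerivAt_deriv_of_contDiffOn hI hf hp
  obtain ⟨hφ1, hφ2⟩ := hasDerivAt_deriv_of_contDiffOn hI hφ hp
  have had : Differentiable ℝ a := ha.differentiable (by simp)
  have ha1 : ∀ i, Differentiable ℝ (partialDeriv i a) := fun i =>
    (contDiff_partialDeriv ha i).differentiable (by simp)
  have hα : DifferentiableAt ℝ (fun t => f t ^ 2 * deriv f t * φ t) (p (Sum.inl 0)) :=
    ((hf1.differentiableAt.pow 2).mul hf2.differentiableAt).mul hφ1.differentiableAt
  have hβ : DifferentiableAt ℝ (fun t => f t ^ 3) (p (Sum.inl 0)) := hf1.differentiableAt.pow 3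
  have h0 : DifferentiableAt ℝ (fun _ => (0 : ℝ)) (p (Sum.inl 0)) := differentiableAt_const 0
  have hz : ∀ i k, (∀ q ∈ warpedDomain I,
      momentum (heisenbergWarpedMetric f) (heisenbergField φ a) i k q = 0) →
      partialDeriv i (momentum (heisenbergWarpedMetric f) (heisenbergField φ a) i k) p = 0 :=
    fun i k h => (partialDeriv_congr_on hU h hp i).trans (partialDeriv_const i 0 p)
  -- Only the divergence `∑_i ∂_i` of the momentum enters, so each entry is differentiated along its
  -- own first index; the entries that vanish identically are left to `hz`.
  have htt := partialDeriv_inl_eq_of_separated hU ((hf1.pow 3).mul hφ2) (hasDerivAt_const _ 0)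
    (differentiable_const 0) (M := momentum (heisenbergWarpedMetric f) (heisenbergField φ a)
      (Sum.inl 0) (Sum.inl 0)) (fun q hq => by simp [hM hq, heisenbergMomentum]) hp
  have htx := partialDeriv_inl_eq_of_separated hU (hasDerivAt_const _ 0) ((hf1.pow 4).mul hf2)
    had (M := momentum (heisenbergWarpedMetric f) (heisenbergField φ a)
      (Sum.inl 0) (Sum.inr 0)) (fun q hq => by simp [hM hq, heisenbergMomentum]) hp
  have hxt := partialDeriv_inr_eq_of_separated hU h0
    (((hf1.differentiableAt.pow 2).mul hf2.differentiableAt).neg)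
    had (M := momentum (heisenbergWarpedMetric f) (heisenbergField φ a)
      (Sum.inr 0) (Sum.inl 0)) (fun q hq => by simp [hM hq, heisenbergMomentum]) hp 0
  have hxx := partialDeriv_inr_eq_of_separated hU hα hβ (ha1 0)
    (M := momentum (heisenbergWarpedMetric f) (heisenbergField φ a) (Sum.inr 0) (Sum.inr 0))
    (fun q hq => by simp [hM hq, heisenbergMomentum]) hp 0
  have hyx := partialDeriv_inr_eq_of_separated hU h0 hβ
    (v := fun q => (1 + q 0 ^ 2) * partialDeriv 1 a q + q 0 * partialDeriv 2 a q)
    (Differentiable.add (Differentiable.mul (by fun_prop) (ha1 1))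
      (Differentiable.mul (by fun_prop) (ha1 2)))
    (M := momentum (heisenbergWarpedMetric f) (heisenbergField φ a) (Sum.inr 1) (Sum.inr 0))
    (fun q hq => by simp [hM hq, heisenbergMomentum]) hp 1
  have hzx := partialDeriv_inr_eq_of_separated hU h0 hβ
    (v := fun q => q 0 * partialDeriv 1 a q + partialDeriv 2 a q)
    (Differentiable.add (Differentiable.mul (by fun_prop) (ha1 1)) (ha1 2))
    (M := momentum (heisenbergWarpedMetric f) (heisenbergField φ a) (Sum.inr 2) (Sum.inr 0))
    (fun q hq => by simp [hM hq, heisenbergMomentum]) hp 2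
  have hyy := partialDeriv_inr_eq_of_separated hU hα hβ
    (v := fun q => (-(q 0) / 2) * a q) (Differentiable.mul (by fun_prop) had)
    (M := momentum (heisenbergWarpedMetric f) (heisenbergField φ a) (Sum.inr 1) (Sum.inr 1))
    (fun q hq => by simp [hM hq, heisenbergMomentum, -mul_eq_mul_left_iff]; ring) hp 1
  have hzy := partialDeriv_inr_eq_of_separated hU h0 hβ
    (v := fun q => (-1 / 2) * a q) (had.const_mul _)
    (M := momentum (heisenbergWarpedMetric f) (heisenbergField φ a) (Sum.inr 2) (Sum.inr 1))
    (fun q hq => by simp [hM hq, heisenbergMomentum, -mul_eq_mul_left_iff]; ring) hp 2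
  have hyz := partialDeriv_inr_eq_of_separated hU h0 hβ
    (v := fun q => ((q 0 ^ 2 - 1) / 2) * a q) (Differentiable.mul (by fun_prop) had)
    (M := momentum (heisenbergWarpedMetric f) (heisenbergField φ a) (Sum.inr 1) (Sum.inr 2))
    (fun q hq => by simp [hM hq, heisenbergMomentum, -mul_eq_mul_left_iff]; ring) hp 1
  have hzz := partialDeriv_inr_eq_of_separated hU hα hβ
    (v := fun q => (q 0 / 2) * a q) (Differentiable.mul (by fun_prop) had)
    (M := momentum (heisenbergWarpedMetric f) (heisenbergField φ a) (Sum.inr 2) (Sum.inr 2))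
    (fun q hq => by simp [hM hq, heisenbergMomentum, -mul_eq_mul_left_iff]; ring) hp 2
  have h10 : (0 : Fin 3) ≠ 1 := by decide
  have h20 : (0 : Fin 3) ≠ 2 := by decide
  rw [partialDeriv_add (u := fun q => (1 + q 0 ^ 2) * partialDeriv 1 a q)
      (v := fun q => q 0 * partialDeriv 2 a q)
      (Differentiable.mul (by fun_prop) (ha1 1) _) (Differentiable.mul (by fun_prop) (ha1 2) _),
    partialDeriv_comp_apply_mul h10 (c := fun x => 1 + x ^ 2) (by fun_prop) (ha1 1),
    partialDeriv_comp_apply_mul h10 (c := fun x => x) (by fun_prop) (ha1 2)] at hyx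
  rw [partialDeriv_add (u := fun q => q 0 * partialDeriv 1 a q)
      (Differentiable.mul (by fun_prop) (ha1 1) _) (ha1 2 _),
    partialDeriv_comp_apply_mul h20 (c := fun x => x) (by fun_prop) (ha1 1)] at hzx
  rw [partialDeriv_comp_apply_mul h10 (c := fun x => -x / 2) (by fun_prop) had] at hyy
  rw [partialDeriv_const_mul _ (had _)] at hzy
  rw [partialDeriv_comp_apply_mul h10 (c := fun x => (x ^ 2 - 1) / 2) (by fun_prop) had] at hyz
  rw [partialDeriv_comp_apply_mul h20 (c := fun x => x / 2) (by fun_prop) had] at hzz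
  have hty := hz (Sum.inl 0) (Sum.inr 1) fun q hq => by simp [hM hq, heisenbergMomentum]
  have htz := hz (Sum.inl 0) (Sum.inr 2) fun q hq => by simp [hM hq, heisenbergMomentum]
  have hyt := hz (Sum.inr 1) (Sum.inl 0) fun q hq => by simp [hM hq, heisenbergMomentum]
  have hzt := hz (Sum.inr 2) (Sum.inl 0) fun q hq => by simp [hM hq, heisenbergMomentum]
  have hxy := hz (Sum.inr 0) (Sum.inr 1) fun q hq => by simp [hM hq, heisenbergMomentum]
  have hxz := hz (Sum.inr 0) (Sum.inr 2) fun q hq => by simp [hM hq, heisenbergMomentum]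
  have hΓ := christoffel_heisenbergWarpedMetric (p := p) hf1.differentiableAt
    (hfpos _ hp).ne'
  have hMp := hM hp
  simp only [roughLaplacian, Fintype.sum_sum_type, Fin.sum_univ_three, Finset.univ_unique,
    Fin.default_eq_zero, Finset.sum_singleton, hΓ, hMp]
  rcases m with m | m <;> fin_cases m
  · simp [htt, hxt, hyt, hzt, heisenbergChristoffel, heisenbergMomentum, ht, hq, hx]
    field_simp
    ring
  · simp [htx, hxx, hyx, hzx, heisenbergChristoffel, heisenbergMomentum, ht, hq, hx]
    field_simp
    ring
  · simp [hty, hxy, hyy, hzy, heisenbergChristoffel, heisenbergMomentum, ht, hq, hx]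
    field_simp
    ring
  · simp [htz, hxz, hyz, hzz, heisenbergChristoffel, heisenbergMomentum, ht, hq, hx]
    field_simp
    ring

/-! ### Harmonicity of `φ ∂_t + a e₁` -/

/-- The factor `f³` is nonzero and cancels. Once `a_y = a_z = 0` holds everywhere, the Laplacian of
`a` reduces to `a_xx`. -/
lemma isHarmonicField_heisenbergField_iff (hI : IsOpen I) (hf : ContDiffOn ℝ ∞ f I)
    (hfpos : ∀ t ∈ I, 0 < f t) (hφ : ContDiffOn ℝ ∞ φ I) (ha : ContDiff ℝ ∞ a) :
    IsHarmonicField (heisenbergWarpedMetric f) (warpedDomain I) (heisenbergField φ a) ↔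
      ∀ t ∈ I, ∀ q,
        deriv (deriv φ) t + 3 * (deriv f t / f t) * deriv φ t - 3 * (deriv f t / f t) ^ 2 * φ t
          = 2 * partialDeriv 0 a q * (deriv f t / f t) ∧
        partialDeriv 0 (partialDeriv 0 a) q
          = a q * (1 / 2 - (f t * deriv (deriv f) t + 2 * deriv f t ^ 2)) ∧
        partialDeriv 1 a q = 0 ∧ partialDeriv 2 a q = 0 := by
  rw [isHarmonicField_iff_roughLaplacian_eq_zero (isOpen_warpedDomain hI)
    (contDiffOn_heisenbergWarpedMetric hf) (fun p _ => isSymm_heisenbergWarpedMetric)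
    (fun p hp => by
      rw [det_heisenbergWarpedMetric]
      exact pow_pos (pow_pos (hfpos _ hp) 3) 2)
    (contDiffOn_heisenbergField hφ ha)]
  have hR := fun {p} (hp : p ∈ warpedDomain I) =>
    roughLaplacian_heisenbergField hI hf hfpos hφ ha hp rfl rfl
  constructor
  · intro h
    have key : ∀ t ∈ I, ∀ q, _ := fun t ht q =>
      fun m => (roughLaplacian_heisenbergField (p := Sum.elim (fun _ => t) q) hI hf hfpos hφ ha
        ht rfl rfl m).symm.trans (h _ ht m)
    have h12 : ∀ t ∈ I, ∀ q, partialDeriv 1 a q = 0 ∧ partialDeriv 2 a q = 0 := by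
      intro t ht q
      have hne := (hfpos t ht).ne'
      have hy := key t ht q (Sum.inr 1)
      have hz := key t ht q (Sum.inr 2)
      simp [hne] at hy hz
      -- The `y` equation is `x a_y + a_z = 0`; inserted into the `z` equation it leaves `a_y = 0`,
      -- and then `a_z = 0`.
      rw [hy] at hz
      have h1 : partialDeriv 1 a q = 0 := by simpa using hz
      exact ⟨h1, by simpa [h1] using hy⟩
    intro t ht q
    have hne := (hfpos t ht).ne'
    have e1 : partialDeriv 1 a = fun _ => 0 := funext fun q => (h12 t ht q).1
    have e2 : partialDeriv 2 a = fun _ => 0 := funext fun q => (h12 t ht q).2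
    have ht' := key t ht q (Sum.inl 0)
    have hx := key t ht q (Sum.inr 0)
    simp [hne, e1, e2, partialDeriv_const] at ht' hx
    refine ⟨by linear_combination -ht', by linear_combination -hx, h12 t ht q⟩
  · intro h p hp m
    have e1 : partialDeriv 1 a = fun _ => 0 := funext fun q => (h _ hp q).2.2.1
    have e2 : partialDeriv 2 a = fun _ => 0 := funext fun q => (h _ hp q).2.2.2
    obtain ⟨h1, h2, -, -⟩ := h _ hp (p ∘ Sum.inr)
    rw [hR hp]
    rcases m with m | m <;> fin_cases m
    · simp [h1]
    · simp [h2, e1, e2, partialDeriv_const]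
    · simp [e1, e2]
    · simp [e1, e2]

/-! ### Separation of variables in the pointwise system -/

lemma eq_affine_of_partialDeriv (ha : Differentiable ℝ a) {κ : ℝ}
    (h0 : ∀ q, partialDeriv 0 a q = κ) (h1 : ∀ q, partialDeriv 1 a q = 0)
    (h2 : ∀ q, partialDeriv 2 a q = 0) (q : Fin 3 → ℝ) : a q = κ * q 0 + a 0 := by
  let L : (Fin 3 → ℝ) →L[ℝ] ℝ := κ • ContinuousLinearMap.proj 0
  have hL : ∀ q, fderiv ℝ a q = L := by
    intro q
    refine ContinuousLinearMap.coe_injective (LinearMap.pi_ext' fun i => LinearMap.ext_ring ?_)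
    have h : fderiv ℝ a q (Pi.single i 1) = L (Pi.single i 1) := by
      fin_cases i
      · simpa [L, partialDeriv] using h0 q
      · simpa [L, partialDeriv] using h1 q
      · simpa [L, partialDeriv] using h2 q
    simpa using h
  -- `a - L` has zero derivative, so it keeps its value `a 0` at the origin.
  have hc := is_const_of_fderiv_eq_zero (𝕜 := ℝ) (ha.sub L.differentiable)
    (fun q => by rw [fderiv_sub (ha q) L.differentiableAt, hL, L.fderiv, sub_self]) q 0
  simp [L] at hc
  linear_combination hc

lemma partialDeriv_affine (κ κ' : ℝ) (i : Fin 3) (q : Fin 3 → ℝ) :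
    partialDeriv i (fun q : Fin 3 → ℝ => κ * q 0 + κ') q = if i = 0 then κ else 0 := by
  rw [partialDeriv_add (u := fun q : Fin 3 → ℝ => κ * q 0) (by fun_prop) (by fun_prop),
    partialDeriv_const_mul (u := fun q : Fin 3 → ℝ => q 0) κ (by fun_prop), partialDeriv_apply,
    partialDeriv_const]
  simp [eq_comm (a := i)]

lemma isHarmonicField_of_heisenbergConditions (hI : IsOpen I) (hf : ContDiffOn ℝ ∞ f I)
    (hfpos : ∀ t ∈ I, 0 < f t) (hφ : ContDiffOn ℝ ∞ φ I) (ha : ContDiff ℝ ∞ a)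
    (h : HeisenbergConditions I f φ a) :
    IsHarmonicField (heisenbergWarpedMetric f) (warpedDomain I) (heisenbergField φ a) := by
  obtain ⟨κ, κ', haff, hf', hφ'⟩ := h
  obtain rfl : a = fun q => κ * q 0 + κ' := funext haff
  have hd := fun i => funext (partialDeriv_affine κ κ' i)
  refine (isHarmonicField_heisenbergField_iff hI hf hfpos hφ ha).2 fun t ht q => ?_
  simp [hd, partialDeriv_const, hf' t ht, hφ' t ht]

lemma exists_deriv_ne_zero (hI : IsOpen I) (hIc : I.OrdConnected) (hf : DifferentiableOn ℝ f I)
    (h : ∃ s ∈ I, ∃ t ∈ I, f s ≠ f t) : ∃ t ∈ I, deriv f t ≠ 0 := by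
  by_contra! h0
  obtain ⟨s, hs, t, ht, hst⟩ := h
  exact hst (hI.is_const_of_deriv_eq_zero hIc.isPreconnected hf (fun t ht => h0 t ht) hs ht)

/-- Nonconstancy of `f` is used to make `a_x` constant, and a point with `a ≠ 0` to extract the
equation for `f`. -/
lemma heisenbergConditions_of_isHarmonicField (hI : IsOpen I) (hIc : I.OrdConnected)
    (hf : ContDiffOn ℝ ∞ f I) (hfpos : ∀ t ∈ I, 0 < f t) (hφ : ContDiffOn ℝ ∞ φ I)
    (ha : ContDiff ℝ ∞ a) (hfc : ∃ s ∈ I, ∃ t ∈ I, f s ≠ f t) (ha0 : ∃ q, a q ≠ 0)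
    (h : IsHarmonicField (heisenbergWarpedMetric f) (warpedDomain I) (heisenbergField φ a)) :
    HeisenbergConditions I f φ a := by
  rw [isHarmonicField_heisenbergField_iff hI hf hfpos hφ ha] at h
  obtain ⟨t₀, ht₀, hft₀⟩ := exists_deriv_ne_zero hI hIc (hf.differentiableOn (by simp)) hfc
  obtain ⟨q₀, hq₀⟩ := ha0
  have hx : ∀ q, partialDeriv 0 a q = partialDeriv 0 a 0 := by
    intro q
    -- The left side of the `t` equation does not involve the fibre point, so the right sides at `q`
    -- and at `0` agree; dividing by `f'/f ≠ 0` compares `a_x` there.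
    have h1 := (h t₀ ht₀ q).1.symm.trans (h t₀ ht₀ 0).1
    have h2 : deriv f t₀ / f t₀ ≠ 0 := div_ne_zero hft₀ (hfpos t₀ ht₀).ne'
    simpa using mul_right_cancel₀ h2 h1
  refine ⟨partialDeriv 0 a 0, a 0, eq_affine_of_partialDeriv (ha.differentiable (by simp)) hx
    (fun q => (h t₀ ht₀ q).2.2.1) (fun q => (h t₀ ht₀ q).2.2.2), fun t ht => ?_,
    fun t ht => (h t ht 0).1⟩
  have h1 := (h t ht q₀).2.1
  -- Since `a_x` is constant, `a_xx = 0`.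
  rw [funext hx, partialDeriv_const] at h1
  have h2 := (mul_eq_zero.1 h1.symm).resolve_left hq₀
  linear_combination -h2

end WarpedHarmonic

end

theorem mainTheorem6 (I : Set ℝ) (hIopen : IsOpen I) (hIint : I.OrdConnected)
    (f φ : ℝ → ℝ) (a : (Fin 3 → ℝ) → ℝ)
    (hf : ContDiffOn ℝ ∞ f I) (hfpos : ∀ t ∈ I, 0 < f t)
    (hφ : ContDiffOn ℝ ∞ φ I) (ha : ContDiff ℝ ∞ a) :
    ((∃ s ∈ I, ∃ t ∈ I, f s ≠ f t) → (∃ q, a q ≠ 0) →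
      (WarpedHarmonic.IsHarmonicField (WarpedHarmonic.heisenbergWarpedMetric f)
          (WarpedHarmonic.warpedDomain I) (WarpedHarmonic.heisenbergField φ a) ↔
        WarpedHarmonic.HeisenbergConditions I f φ a)) ∧
    (WarpedHarmonic.HeisenbergConditions I f φ a →
      WarpedHarmonic.IsHarmonicField (WarpedHarmonic.heisenbergWarpedMetric f)
        (WarpedHarmonic.warpedDomain I) (WarpedHarmonic.heisenbergField φ a)) :=
  ⟨fun hfc ha0 => ⟨WarpedHarmonic.heisenbergConditions_of_isHarmonicField hIopen hIint hf hfpos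
      hφ ha hfc ha0,
    WarpedHarmonic.isHarmonicField_of_heisenbergConditions hIopen hf hfpos hφ ha⟩,
    WarpedHarmonic.isHarmonicField_of_heisenbergConditions hIopen hf hfpos hφ ha⟩
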